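/- Theorem 3.2. Let $R$ be an associative ring with unit; "module" means right $R$-module. A module $M$ is a $C_1$-module if every submodule of $M$ is essential in a direct summand of $M$; a $C_2$-module if every submodule of $M$ that is isomorphic to a direct summand of $M$ is itself a direct summand of $M$; a $C_3$-module if $A+B$ is a direct summand of $M$ whenever $A,B$ are direct summands of $M$ with $A\cap B=0$; quasi-continuous if it is $C_1$ and $C_3$; continuous if it is $C_1$ and $C_2$; quasi-injective if every homomorphism from a submodule of $M$ to $M$ extends to an endomorphism of $M$. Let $\mathcal C_2,\mathcal C_3,\mathcal C_4,\mathcal C_5,\mathcal C_6$ be the classes of all $C_2$-, $C_3$-, quasi-continuous, continuous and quasi-injective modules, respectively. For a class $\mathcal C$ of modules, a $\mathcal C$-preenvelope of $M$ is a homomorphism $g:M\to E$ with $E\in\mathcal C$ such that every homomorphism $g':M\to E'$ with $E'\in\mathcal C$ is of the form $g'=\alpha g$ for some $\alpha:E\to E'$; it is a $\mathcal C$-envelope if moreover every endomorphism $\alpha$ of $E$ with $\alpha g=g$ is an automorphism. $\mathcal C$-precovers and $\mathcal C$-covers $g:E\to M$ are defined dually. The class $\mathcal C$ is preenveloping (enveloping,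 precovering, covering) if every module has a $\mathcal C$-preenvelope ($\mathcal C$-envelope, $\mathcal C$-precover, $\mathcal C$-cover). Let $2\le i\le 6$. Then the following conditions are equivalent: (1) $\mathcal C_i$ is closed under finite direct sums; (2) $\mathcal C_i$ is the class of all injective modules; (3) $\mathcal C_i$ is preenveloping; (3') $\mathcal C_i$ is enveloping; (4) $\mathcal C_i$ is precovering; (4') $\mathcal C_i$ is covering. If these conditions hold, then $R$ is right noetherian and a right V-ring (every simple module is injective); moreover, all semisimple modules are injective. If $i\neq 6$, then these conditions are also equivalent to (5) $R$ is a semisimple artinian ring. -/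

import Mathlib

universe u

open scoped DirectSum

namespace GenInj

/-! Modules over a ring `S` are left `S`-modules below; right `R`-modules are modules over `Rᵐᵒᵖ`. -/

section Modules

variable (S : Type u) [Ring S] (M : Type u) [AddCommGroup M] [Module S M]

/-- `N` is an essential submodule of `D`: it is contained in `D` and meets every nonzero
submodule of `D` nontrivially. -/
def IsEssentialIn {S M : Type u} [Ring S] [AddCommGroup M] [Module S M]
    (N D : Submodule S M) : Prop :=
  N ≤ D ∧ ∀ K : Submodule S M, K ≤ D → K ⊓ N = ⊥ → K = ⊥

/-- `C₁`-modules: every submodule is essential in a direct summand.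
A submodule is a direct summand iff it is complemented in the lattice of submodules. -/
def IsC1 : Prop :=
  ∀ N : Submodule S M, ∃ D : Submodule S M, IsComplemented D ∧ IsEssentialIn N D

/-- `C₂`-modules: a submodule isomorphic to a direct summand is a direct summand. -/
def IsC2 : Prop :=
  ∀ A D : Submodule S M, IsComplemented D → Nonempty (A ≃ₗ[S] D) → IsComplemented A

/-- `C₃`-modules: the sum of two direct summands with zero intersection is a direct summand. -/
def IsC3 : Prop :=
  ∀ A B : Submodule S M, IsComplemented A → IsComplemented B → A ⊓ B = ⊥ → IsComplemented (A ⊔ B)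

/-- Quasi-continuous modules. -/
def IsQuasiContinuous : Prop := IsC1 S M ∧ IsC3 S M

/-- Continuous modules. -/
def IsContinuous : Prop := IsC1 S M ∧ IsC2 S M

/-- Quasi-injective modules: every homomorphism from a submodule of `M` to `M` extends to `M`. -/
def IsQuasiInjective : Prop :=
  ∀ (N : Submodule S M) (g : N →ₗ[S] M), ∃ h : M →ₗ[S] M, ∀ x : N, h x = g x

end Modules

/-- A class of `S`-modules. -/
abbrev ModuleClass (S : Type u) [Ring S] : Type (u + 1) :=
  ∀ (M : Type u) [AddCommGroup M] [Module S M], Prop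

/-- The classes `𝒞₁, …, 𝒞₆` (the value at other indices is the empty class and is never used). -/
def classC (S : Type u) [Ring S] (i : ℕ) : ModuleClass S := fun M _ _ =>
  match i with
  | 1 => IsC1 S M
  | 2 => IsC2 S M
  | 3 => IsC3 S M
  | 4 => IsQuasiContinuous S M
  | 5 => IsContinuous S M
  | 6 => IsQuasiInjective S M
  | _ => False

namespace ModuleClass

variable {S : Type u} [Ring S] (C : ModuleClass S)

/-- Closure under finite direct sums. -/
def ClosedUnderFiniteDirectSums : Prop :=
  ∀ (n : ℕ) (M : Fin n → Type u) [∀ k, AddCommGroup (M k)] [∀ k, Module S (M k)],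
    (∀ k, C (M k)) → C (⨁ k, M k)

section Maps

variable {M E : Type u} [AddCommGroup M] [Module S M] [AddCommGroup E] [Module S E]

/-- `g : M → E` is a `C`-preenvelope of `M`. -/
def IsPreenvelope (g : M →ₗ[S] E) : Prop :=
  C E ∧ ∀ (E' : Type u) [AddCommGroup E'] [Module S E'], C E' →
    ∀ g' : M →ₗ[S] E', ∃ α : E →ₗ[S] E', α ∘ₗ g = g'

/-- `g : M → E` is a `C`-envelope of `M`. -/
def IsEnvelope (g : M →ₗ[S] E) : Prop :=
  C.IsPreenvelope g ∧ ∀ α : E →ₗ[S] E, α ∘ₗ g = g → Function.Bijective α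

/-- `g : E → M` is a `C`-precover of `M`. -/
def IsPrecover (g : E →ₗ[S] M) : Prop :=
  C E ∧ ∀ (E' : Type u) [AddCommGroup E'] [Module S E'], C E' →
    ∀ g' : E' →ₗ[S] M, ∃ α : E' →ₗ[S] E, g ∘ₗ α = g'

/-- `g : E → M` is a `C`-cover of `M`. -/
def IsCover (g : E →ₗ[S] M) : Prop :=
  C.IsPrecover g ∧ ∀ α : E →ₗ[S] E, g ∘ₗ α = g → Function.Bijective α

end Maps

/-- Every module has a `C`-preenvelope. -/
def Preenveloping : Prop :=
  ∀ (M : Type u) [AddCommGroup M] [Module S M],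
    ∃ (E : Type u) (_ : AddCommGroup E) (_ : Module S E) (g : M →ₗ[S] E), C.IsPreenvelope g

/-- Every module has a `C`-envelope. -/
def Enveloping : Prop :=
  ∀ (M : Type u) [AddCommGroup M] [Module S M],
    ∃ (E : Type u) (_ : AddCommGroup E) (_ : Module S E) (g : M →ₗ[S] E), C.IsEnvelope g

/-- Every module has a `C`-precover. -/
def Precovering : Prop :=
  ∀ (M : Type u) [AddCommGroup M] [Module S M],
    ∃ (E : Type u) (_ : AddCommGroup E) (_ : Module S E) (g : E →ₗ[S] M), C.IsPrecover g

/-- Every module has a `C`-cover. -/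
def Covering : Prop :=
  ∀ (M : Type u) [AddCommGroup M] [Module S M],
    ∃ (E : Type u) (_ : AddCommGroup E) (_ : Module S E) (g : E →ₗ[S] M), C.IsCover g

end ModuleClass

/-- Right noetherian rings: `R` is noetherian as a right module over itself. -/
def IsRightNoetherian (R : Type u) [Ring R] : Prop := IsNoetherian Rᵐᵒᵖ R

/-- Right V-rings: every simple right module is injective. -/
def IsRightVRing (R : Type u) [Ring R] : Prop :=
  ∀ (M : Type u) [AddCommGroup M] [Module Rᵐᵒᵖ M],
    IsSimpleModule Rᵐᵒᵖ M → Module.Injective Rᵐᵒᵖ M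

end GenInj

/-! All five classes contain the injective and the semisimple modules, are closed under direct
summands, and lie in the class of `C₃`-modules. Everything rests on one splitting argument: if `M ⊕
Q` is `C₃` and `f : M → Q` is a monomorphism, then the graph of `f` and `M` are summands with zero
intersection whose sum is `M ⊕ f(M)`, so `f` splits. With `Q` injective, closure under finite sums
makes every module of the class injective. Conversely, a preenvelope or precover of a finite sum of
modules in the class exhibits that sum as a retract of a module in the class, which gives closure.

If the class is that of the injectives, injective hulls are envelopes. For covers, injectivity of
all semisimple modules makes the ring noetherian; injectives are then closed under direct sums and
directed unions. Every map from an injective module to `M` factors through a sum of injectives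
indexed by a set (`exists_factorization_of_injective`), and splitting off a maximal injective
submodule of the kernel turns this precover into a cover.

For semisimplicity when `i ≠ 6`: a noetherian ring that is not semisimple has a uniform injective
module `E` that is not semisimple. Since simple modules cogenerate, `E` has a maximal submodule; it
is continuous, hence injective, hence a summand of the uniform module `E`, which is impossible. -/

namespace GenInj

/-! ### Direct summands, retracts and injectivity -/

section Retracts

variable {S : Type u} [Ring S] {M E : Type u} [AddCommGroup M] [Module S M]
  [AddCommGroup E] [Module S E]

theorem isComplemented_of_proj {A : Submodule S M} (p : M →ₗ[S] M) (hp : ∀ x, p x ∈ A)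
    (hpA : ∀ a ∈ A, p a = a) : IsComplemented A :=
  ⟨_, LinearMap.isCompl_of_proj (f := p.codRestrict A hp) fun x => Subtype.ext (hpA x x.2)⟩

theorem exists_proj_of_isComplemented {A : Submodule S M} (h : IsComplemented A) :
    ∃ p : M →ₗ[S] A, ∀ a : A, p a = a := by
  obtain ⟨B, hB⟩ := h
  exact ⟨A.projectionOnto B hB, fun a => Submodule.projectionOnto_apply_left hB a⟩

theorem isComplemented_map_of_retract {i : M →ₗ[S] E} {p : E →ₗ[S] M} (hpi : ∀ x, p (i x) = x)
    {A : Submodule S M} : IsComplemented (A.map i) ↔ IsComplemented A := by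
  constructor
  · intro h
    obtain ⟨q, hq⟩ := exists_proj_of_isComplemented h
    refine isComplemented_of_proj (p ∘ₗ (A.map i).subtype ∘ₗ q ∘ₗ i) (fun x => ?_) fun a ha => ?_
    · obtain ⟨a, ha, hax⟩ := (q (i x)).2
      change p (q (i x)) ∈ A
      rw [← hax, hpi]
      exact ha
    · have := hq ⟨i a, Submodule.mem_map_of_mem ha⟩
      change p (q (i a)) = a
      rw [this]
      exact hpi a
  · intro h
    obtain ⟨q, hq⟩ := exists_proj_of_isComplemented h
    refine isComplemented_of_proj (i ∘ₗ A.subtype ∘ₗ q ∘ₗ p) (fun x => ?_) fun a ha => ?_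
    · exact Submodule.mem_map_of_mem (q (p x)).2
    · obtain ⟨b, hb, rfl⟩ := ha
      change i (q (p (i b))) = i b
      rw [hpi, hq ⟨b, hb⟩]

theorem injective_of_retract [Module.Injective S E] (i : M →ₗ[S] E) (p : E →ₗ[S] M)
    (hpi : ∀ x, p (i x) = x) : Module.Injective S M where
  out X Y _ _ _ _ f hf g := by
    obtain ⟨h, hh⟩ := Module.Injective.extension_property S E X Y f hf (i ∘ₗ g)
    exact ⟨p ∘ₗ h, fun x => by
      have := LinearMap.congr_fun hh x
      simp only [LinearMap.comp_apply] at this ⊢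
      rw [this, hpi]⟩

theorem injective_of_linearEquiv (hE : Module.Injective S E) (e : M ≃ₗ[S] E) :
    Module.Injective S M :=
  injective_of_retract e.toLinearMap e.symm.toLinearMap fun x => e.symm_apply_apply x

theorem injective_of_isComplemented [Module.Injective S E] {A : Submodule S E}
    (h : IsComplemented A) : Module.Injective S A := by
  obtain ⟨q, hq⟩ := exists_proj_of_isComplemented h
  exact injective_of_retract A.subtype q hq

theorem exists_extension (hE : Module.Injective S E) {A : Submodule S M} (f : A →ₗ[S] E) :
    ∃ h : M →ₗ[S] E, ∀ a : A, h a = f a := by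
  obtain ⟨h, hh⟩ := Module.Injective.extension_property S E A M A.subtype
    (Submodule.subtype_injective A) f
  exact ⟨h, fun a => LinearMap.congr_fun hh a⟩

theorem isComplemented_of_injective {A : Submodule S E} (h : Module.Injective S A) :
    IsComplemented A := by
  obtain ⟨p, hp⟩ := exists_extension h (LinearMap.id : A →ₗ[S] A)
  exact ⟨_, LinearMap.isCompl_of_proj hp⟩

theorem isComplemented_range_of_injective (hM : Module.Injective S M) {f : M →ₗ[S] E}
    (hf : Function.Injective f) : IsComplemented (LinearMap.range f) :=
  isComplemented_of_injective
    (injective_of_linearEquiv hM (LinearEquiv.ofInjective f hf).symm)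

theorem exists_injective_embedding (S : Type u) [Ring S] (M : Type u) [AddCommGroup M]
    [Module S M] : ∃ (Q : Type u) (_ : AddCommGroup Q) (_ : Module S Q) (f : M →ₗ[S] Q),
      Module.Injective S Q ∧ Function.Injective f := by
  let Q := CategoryTheory.Injective.under (ModuleCat.of S M)
  let f := CategoryTheory.Injective.ι (ModuleCat.of S M)
  refine ⟨Q, inferInstance, inferInstance, f.hom, ?_, ?_⟩
  · rw [Module.injective_iff_injective_object]
    exact inferInstanceAs (CategoryTheory.Injective Q)
  · exact (ModuleCat.mono_iff_injective f).1 inferInstance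

end Retracts

/-! ### Essential extensions and injective hulls -/

section Essential

variable {S : Type u} [Ring S] {M E : Type u} [AddCommGroup M] [Module S M]
  [AddCommGroup E] [Module S E]

theorem isEssentialIn_refl (N : Submodule S M) : IsEssentialIn N N :=
  ⟨le_rfl, fun K hK h => by rwa [inf_eq_left.2 hK] at h⟩

theorem IsEssentialIn.trans {N D F : Submodule S M} (h₁ : IsEssentialIn N D)
    (h₂ : IsEssentialIn D F) : IsEssentialIn N F := by
  refine ⟨h₁.1.trans h₂.1, fun K hK h => h₂.2 K hK (h₁.2 _ inf_le_right ?_)⟩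
  rw [inf_assoc, inf_eq_right.2 h₁.1, h]

theorem isEssentialIn_iff_exists_smul {N D : Submodule S M} :
    IsEssentialIn N D ↔ N ≤ D ∧ ∀ x ∈ D, x ≠ 0 → ∃ r : S, r • x ∈ N ∧ r • x ≠ 0 := by
  refine and_congr_right fun _ => ⟨fun h x hx hx0 => ?_, fun h K hK hKN => ?_⟩
  · by_contra! hr
    refine hx0 (Submodule.span_singleton_eq_bot.1
      (h (Submodule.span S {x}) ((Submodule.span_singleton_le_iff_mem x D).2 hx) ?_))
    rw [eq_bot_iff]
    rintro y ⟨hy, hyN⟩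
    obtain ⟨r, rfl⟩ := Submodule.mem_span_singleton.1 hy
    exact hr r hyN
  · rw [eq_bot_iff]
    intro x hx
    by_contra hx0
    obtain ⟨r, hr, hr0⟩ := h x (hK hx) hx0
    exact hr0 ((Submodule.mem_bot S).1 (hKN ▸ ⟨K.smul_mem r hx, hr⟩))

theorem exists_maximal_isEssentialIn (N : Submodule S M) :
    ∃ D, IsEssentialIn N D ∧ ∀ D', IsEssentialIn N D' → D ≤ D' → D' = D := by
  obtain ⟨D, -, hD⟩ := zorn_le_nonempty₀ {D | IsEssentialIn N D} (fun c hc hchain y hy => by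
    refine ⟨sSup c, isEssentialIn_iff_exists_smul.2 ⟨(hc hy).1.trans (le_sSup hy), ?_⟩,
      fun z hz => le_sSup hz⟩
    intro x hx hx0
    obtain ⟨z, hz, hxz⟩ := (Submodule.mem_sSup_of_directed ⟨y, hy⟩ hchain.directedOn).1 hx
    exact (isEssentialIn_iff_exists_smul.1 (hc hz)).2 x hxz hx0) N (isEssentialIn_refl N)
  exact ⟨D, hD.prop, fun D' h hle => le_antisymm (hD.2 h hle) hle⟩

theorem exists_maximal_disjoint (D : Submodule S M) :
    ∃ K : Submodule S M, K ⊓ D = ⊥ ∧ ∀ K', K' ⊓ D = ⊥ → K ≤ K' → K' = K := by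
  obtain ⟨K, -, hK⟩ := zorn_le_nonempty₀ {K : Submodule S M | K ⊓ D = ⊥}
    (fun c hc hchain y hy => by
      refine ⟨sSup c, ?_, fun z hz => le_sSup hz⟩
      change sSup c ⊓ D = ⊥
      rw [eq_bot_iff]
      rintro x ⟨hx, hxD⟩
      obtain ⟨z, hz, hxz⟩ := (Submodule.mem_sSup_of_directed ⟨y, hy⟩ hchain.directedOn).1 hx
      exact (hc hz).le ⟨hxz, hxD⟩) ⊥ (show (⊥ : Submodule S M) ⊓ D = ⊥ from bot_inf_eq _)
  exact ⟨K, hK.prop, fun K' h hle => le_antisymm (hK.2 h hle) hle⟩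

theorem ker_eq_bot_of_isEssentialIn {N : Submodule S M} (hN : IsEssentialIn N ⊤)
    {f : M →ₗ[S] E} (hf : ∀ x ∈ N, f x = 0 → x = 0) : Function.Injective f := by
  rw [← LinearMap.ker_eq_bot]
  refine hN.2 _ le_top ?_
  rw [eq_bot_iff]
  rintro x ⟨hx, hxN⟩
  exact hf x hxN hx

/-- An injective module is a `C₁`-module. -/
theorem isC1_of_injective (hE : Module.Injective S E) : IsC1 S E := by
  intro N
  obtain ⟨D, hND, hD⟩ := exists_maximal_isEssentialIn N
  refine ⟨D, ?_, hND⟩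
  -- `D` embeds in `E ⧸ K`, so its inclusion into `E` extends to `E ⧸ K`. Maximality of `K` makes
  -- the image of that extension essential over `D`; maximality of `D` makes it equal to `D`, so `g`
  -- is a projection.
  obtain ⟨K, hKD, hK⟩ := exists_maximal_disjoint D
  have hinj : Function.Injective (K.mkQ ∘ₗ D.subtype) := by
    rw [← LinearMap.ker_eq_bot, eq_bot_iff]
    intro x hx
    have hxK : (x : E) ∈ K := by simpa using hx
    have : (x : E) ∈ K ⊓ D := ⟨hxK, x.2⟩
    rw [hKD] at this
    simpa using this
  obtain ⟨f, hf⟩ := Module.Injective.extension_property S E D (E ⧸ K) _ hinj D.subtype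
  have hfD : ∀ x ∈ D, f (K.mkQ x) = x := fun x hx => LinearMap.congr_fun hf ⟨x, hx⟩
  let g : E →ₗ[S] E := f ∘ₗ K.mkQ
  have hKg : K ≤ LinearMap.ker g := fun x hx => by
    have : K.mkQ x = 0 := by simpa using hx
    simp [g, this]
  have hDg : D ≤ LinearMap.range g := fun x hx => ⟨x, hfD x hx⟩
  have hess : IsEssentialIn D (LinearMap.range g) := by
    refine ⟨hDg, fun L hL hLD => ?_⟩
    have hcomap : L.comap g = K := by
      refine hK _ ?_ fun x hx => ?_
      · rw [eq_bot_iff]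
        rintro x ⟨hx, hxD⟩
        have : g x = x := hfD x hxD
        rw [← hLD]
        refine ⟨?_, hxD⟩
        rw [← this]
        exact hx
      · change g x ∈ L
        rw [LinearMap.mem_ker.1 (hKg hx)]
        exact L.zero_mem
    rw [eq_bot_iff]
    intro y hy
    obtain ⟨x, rfl⟩ := hL hy
    have : x ∈ K := hcomap ▸ (show x ∈ L.comap g from hy)
    exact LinearMap.mem_ker.1 (hKg this)
  have hrange := hD _ (hND.trans hess) hDg
  exact isComplemented_of_proj g (fun x => hrange ▸ LinearMap.mem_range_self g x) hfD

/-- Every module has an injective hull. -/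
theorem exists_injective_hull (S : Type u) [Ring S] (M : Type u) [AddCommGroup M]
    [Module S M] : ∃ (E : Type u) (_ : AddCommGroup E) (_ : Module S E) (g : M →ₗ[S] E),
      Module.Injective S E ∧ Function.Injective g ∧ IsEssentialIn (LinearMap.range g) ⊤ := by
  obtain ⟨Q, _, _, f, hQ, hf⟩ := exists_injective_embedding S M
  obtain ⟨H, hHc, hH⟩ := isC1_of_injective hQ (LinearMap.range f)
  let g : M →ₗ[S] H := f.codRestrict H fun x => hH.1 (LinearMap.mem_range_self f x)
  refine ⟨H, inferInstance, inferInstance, g, injective_of_isComplemented hHc,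
    fun x y h => hf (congrArg Subtype.val h), le_top, fun K _ hK => ?_⟩
  have := hH.2 (K.map H.subtype) (Submodule.map_subtype_le H K) (by
    rw [eq_bot_iff]
    rintro _ ⟨⟨y, hy, rfl⟩, ⟨x, hx⟩⟩
    have : y ∈ K ⊓ LinearMap.range g := ⟨hy, x, Subtype.ext hx⟩
    rw [hK] at this
    simpa using this)
  exact Submodule.map_injective_of_injective (Submodule.subtype_injective H)
    (this.trans (Submodule.map_bot _).symm)

end Essential

/-! ### The classes: inclusions, retracts, and closure under finite sums -/

section Classes

variable {S : Type u} [Ring S] {M E : Type u} [AddCommGroup M] [Module S M]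
  [AddCommGroup E] [Module S E]

/-- Let `π` be the projection with kernel `A`. It is injective on `B`, so `π(B) ≅ B` is a summand by
`C₂`, and `A ⊕ B = A ⊕ π(B)`; with `q` projecting onto `π(B)`, the map `p + qπ` projects onto this
sum. -/
theorem IsC2.isC3 (h : IsC2 S M) : IsC3 S M := by
  rintro A B ⟨A', hA⟩ hB hAB
  let p := A.projection A' hA
  let π : M →ₗ[S] M := LinearMap.id - p
  have hpA : ∀ a ∈ A, p a = a := fun a ha => A.projection_apply_of_mem_left hA ha
  have hpm : ∀ x, p x ∈ A := fun x => A.projection_apply_mem hA x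
  have hinj : Function.Injective (π ∘ₗ B.subtype) := by
    rw [← LinearMap.ker_eq_bot, eq_bot_iff]
    intro b hb
    have hb' : (b : M) - p b = 0 := hb
    have : (b : M) ∈ A ⊓ B := ⟨by rw [sub_eq_zero.1 hb']; exact hpm b, b.2⟩
    rw [hAB] at this
    simpa using this
  obtain ⟨q, hq⟩ := exists_proj_of_isComplemented
    (h (LinearMap.range (π ∘ₗ B.subtype)) B hB ⟨(LinearEquiv.ofInjective _ hinj).symm⟩)
  have hmem : ∀ y : LinearMap.range (π ∘ₗ B.subtype), (y : M) ∈ A ⊔ B := by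
    rintro ⟨_, b, rfl⟩
    exact sub_mem (Submodule.mem_sup_right b.2) (Submodule.mem_sup_left (hpm b))
  have hqπ : ∀ b ∈ B, (q (π b) : M) = π b := fun b hb =>
    congrArg Subtype.val (hq ⟨π b, ⟨b, hb⟩, rfl⟩)
  have hπA : ∀ a ∈ A, π a = 0 := fun a ha => sub_eq_zero.2 (hpA a ha).symm
  refine isComplemented_of_proj (p + Submodule.subtype _ ∘ₗ q ∘ₗ π)
    (fun x => add_mem (Submodule.mem_sup_left (hpm x)) (hmem _)) fun x hx => ?_
  obtain ⟨a, ha, b, hb, rfl⟩ := Submodule.mem_sup.1 hx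
  change p (a + b) + (q (π (a + b)) : M) = a + b
  rw [map_add π, hπA a ha, zero_add, hqπ b hb, map_add, hpA a ha]
  change a + p b + (b - p b) = a + b
  abel

theorem IsQuasiInjective.isC2 (h : IsQuasiInjective S M) : IsC2 S M := by
  rintro A D hD ⟨e⟩
  obtain ⟨p, hp⟩ := exists_proj_of_isComplemented hD
  obtain ⟨k, hk⟩ := h A (D.subtype ∘ₗ e.toLinearMap)
  refine isComplemented_of_proj (A.subtype ∘ₗ e.symm.toLinearMap ∘ₗ p ∘ₗ k) (fun x => ?_)
    fun a ha => ?_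
  · exact (e.symm (p (k x))).2
  · change ((e.symm (p (k a)) : A) : M) = a
    have : k a = e ⟨a, ha⟩ := hk ⟨a, ha⟩
    rw [this, hp, e.symm_apply_apply]

theorem isQuasiInjective_of_injective (hM : Module.Injective S M) : IsQuasiInjective S M :=
  fun _ g => exists_extension hM g

theorem isQuasiInjective_of_isSemisimpleModule [IsSemisimpleModule S M] :
    IsQuasiInjective S M := fun N g => by
  obtain ⟨p, hp⟩ := exists_proj_of_isComplemented (exists_isCompl N)
  exact ⟨g ∘ₗ p, fun x => congrArg g (hp x)⟩

theorem isC1_of_isSemisimpleModule [IsSemisimpleModule S M] : IsC1 S M :=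
  fun N => ⟨N, exists_isCompl N, isEssentialIn_refl N⟩

section Retract

variable {i : M →ₗ[S] E} {p : E →ₗ[S] M}

/-- Take `C` with no proper essential extension in `M`, and a summand `D` of `E` in which `i(C)` is
essential. Then `p` is injective on `D` and `p(D)` is essential over `C`, so `p(D) = C`; this forces
`D = i(C)`. -/
theorem IsC1.of_retract (hpi : ∀ x, p (i x) = x) (h : IsC1 S E) : IsC1 S M := by
  intro N
  obtain ⟨C, hNC, hC⟩ := exists_maximal_isEssentialIn N
  refine ⟨C, ?_, hNC⟩
  obtain ⟨D, hD, hCD⟩ := h (C.map i)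
  have hker : ∀ x ∈ D, p x = 0 → x = 0 := by
    have := hCD.2 (D ⊓ LinearMap.ker p) inf_le_left (by
      rw [eq_bot_iff]
      rintro _ ⟨⟨-, hx⟩, c, hc, rfl⟩
      have : c = 0 := (hpi c).symm.trans (LinearMap.mem_ker.1 hx)
      simp [this])
    intro x hx hpx
    have hx' : x ∈ D ⊓ LinearMap.ker p := ⟨hx, hpx⟩
    rwa [this] at hx'
  have hCp : C ≤ D.map p := fun c hc => ⟨i c, hCD.1 (Submodule.mem_map_of_mem hc), hpi c⟩
  have hess : IsEssentialIn C (D.map p) := by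
    refine isEssentialIn_iff_exists_smul.2 ⟨hCp, ?_⟩
    rintro _ ⟨x, hx, rfl⟩ hx0
    obtain ⟨r, ⟨c, hc, hcr⟩, hr0⟩ := (isEssentialIn_iff_exists_smul.1 hCD).2 x hx
      (fun h0 => hx0 (by rw [h0, map_zero]))
    have hpc : r • p x = c := by rw [← map_smul, ← hcr, hpi]
    refine ⟨r, hpc ▸ hc, fun h0 => hr0 ?_⟩
    rw [← hcr, ← hpc, h0, map_zero]
  have hmap := hC _ (hNC.trans hess) hCp
  have hDC : D = C.map i := by
    refine le_antisymm (fun x hx => ⟨p x, hmap ▸ Submodule.mem_map_of_mem hx, ?_⟩) hCD.1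
    have hpx : p x ∈ C := hmap ▸ Submodule.mem_map_of_mem hx
    refine sub_eq_zero.1 (hker _ (sub_mem (hCD.1 (Submodule.mem_map_of_mem hpx)) hx) ?_)
    rw [map_sub, hpi, sub_self]
  exact (isComplemented_map_of_retract hpi).1 (hDC ▸ hD)

theorem IsC2.of_retract (hpi : ∀ x, p (i x) = x) (h : IsC2 S E) : IsC2 S M := by
  rintro A D hD ⟨e⟩
  have hi : Function.Injective i := Function.LeftInverse.injective hpi
  exact (isComplemented_map_of_retract hpi).1 (h _ _ ((isComplemented_map_of_retract hpi).2 hD)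
    ⟨(Submodule.equivMapOfInjective i hi A).symm ≪≫ₗ e ≪≫ₗ
      Submodule.equivMapOfInjective i hi D⟩)

theorem IsC3.of_retract (hpi : ∀ x, p (i x) = x) (h : IsC3 S E) : IsC3 S M := by
  intro A B hA hB hAB
  have hi : Function.Injective i := Function.LeftInverse.injective hpi
  rw [← isComplemented_map_of_retract hpi] at hA hB ⊢
  rw [Submodule.map_sup]
  refine h _ _ hA hB ?_
  rw [← Submodule.map_inf i hi, hAB, Submodule.map_bot]

theorem IsQuasiInjective.of_retract (hpi : ∀ x, p (i x) = x) (h : IsQuasiInjective S E) :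
    IsQuasiInjective S M := by
  intro N g
  have hi : Function.Injective i := Function.LeftInverse.injective hpi
  let e := Submodule.equivMapOfInjective i hi N
  obtain ⟨k, hk⟩ := h (N.map i) (i ∘ₗ g ∘ₗ e.symm.toLinearMap)
  refine ⟨p ∘ₗ k ∘ₗ i, fun x => ?_⟩
  have hx : k (i x) = i (g (e.symm (e x))) := hk (e x)
  change p (k (i x)) = g x
  rw [hx, e.symm_apply_apply, hpi]

end Retract

variable {n : ℕ}

theorem classC_of_retract (h2 : 2 ≤ n) (h6 : n ≤ 6) (i : M →ₗ[S] E) (p : E →ₗ[S] M)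
    (hpi : ∀ x, p (i x) = x) (h : classC S n E) : classC S n M := by
  interval_cases n
  · exact IsC2.of_retract hpi h
  · exact IsC3.of_retract hpi h
  · exact ⟨IsC1.of_retract hpi h.1, IsC3.of_retract hpi h.2⟩
  · exact ⟨IsC1.of_retract hpi h.1, IsC2.of_retract hpi h.2⟩
  · exact IsQuasiInjective.of_retract hpi h

theorem isC3_of_classC (h2 : 2 ≤ n) (h6 : n ≤ 6) (h : classC S n M) : IsC3 S M := by
  interval_cases n
  · exact IsC2.isC3 h
  · exact h
  · exact h.2
  · exact IsC2.isC3 h.2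
  · exact (IsQuasiInjective.isC2 h).isC3

theorem classC_of_isContinuous (h2 : 2 ≤ n) (h5 : n ≤ 5) (h : IsContinuous S M) :
    classC S n M := by
  interval_cases n
  · exact h.2
  · exact h.2.isC3
  · exact ⟨h.1, h.2.isC3⟩
  · exact h

theorem classC_of_isC1_of_isQuasiInjective (h2 : 2 ≤ n) (h6 : n ≤ 6) (h₁ : IsC1 S M)
    (h : IsQuasiInjective S M) : classC S n M := by
  obtain h5 | rfl := Nat.lt_or_eq_of_le h6
  · exact classC_of_isContinuous h2 (by omega) ⟨h₁, h.isC2⟩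
  · exact h

theorem classC_of_injective (h2 : 2 ≤ n) (h6 : n ≤ 6) (h : Module.Injective S M) :
    classC S n M :=
  classC_of_isC1_of_isQuasiInjective h2 h6 (isC1_of_injective h) (isQuasiInjective_of_injective h)

theorem classC_of_isSemisimpleModule (h2 : 2 ≤ n) (h6 : n ≤ 6) [IsSemisimpleModule S M] :
    classC S n M :=
  classC_of_isC1_of_isQuasiInjective h2 h6 isC1_of_isSemisimpleModule
    isQuasiInjective_of_isSemisimpleModule

/-- If a `C₃`-module has direct summands `M` and `E` in direct sum position, then every
monomorphism `M → E` splits. -/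
theorem IsC3.exists_leftInverse {X : Type u} [AddCommGroup X] [Module S X] (h : IsC3 S X)
    {ιM : M →ₗ[S] X} {ιE : E →ₗ[S] X} {πM : X →ₗ[S] M} {πE : X →ₗ[S] E}
    (hMM : ∀ x, πM (ιM x) = x) (hEE : ∀ x, πE (ιE x) = x) (hME : ∀ x, πM (ιE x) = 0)
    (hEM : ∀ x, πE (ιM x) = 0) {f : M →ₗ[S] E} (hf : Function.Injective f) :
    ∃ q : E →ₗ[S] M, ∀ x, q (f x) = x := by
  -- The range of `γ` is the graph of `f`.
  let γ : M →ₗ[S] X := ιM + ιE ∘ₗ f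
  have hγ : ∀ x, γ x = ιM x + ιE (f x) := fun _ => rfl
  have hπγ : ∀ x, πM (γ x) = x := fun x => by rw [hγ, map_add, hMM, hME, add_zero]
  have hA : IsComplemented (LinearMap.range γ) :=
    isComplemented_of_proj (γ ∘ₗ πM) (fun x => ⟨πM x, rfl⟩) (by
      rintro _ ⟨x, rfl⟩
      exact congrArg γ (hπγ x))
  have hB : IsComplemented (LinearMap.range ιM) :=
    isComplemented_of_proj (ιM ∘ₗ πM) (fun x => ⟨πM x, rfl⟩) (by
      rintro _ ⟨x, rfl⟩
      exact congrArg ιM (hMM x))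
  have hAB : LinearMap.range γ ⊓ LinearMap.range ιM = ⊥ := by
    rw [eq_bot_iff]
    rintro _ ⟨⟨x, rfl⟩, y, hy⟩
    have h0 := congrArg πE hy
    rw [hγ, map_add, hEM, hEM, hEE, zero_add] at h0
    have : x = 0 := hf (by rw [← h0, map_zero])
    simp [this]
  obtain ⟨q, hq⟩ := exists_proj_of_isComplemented (h _ _ hA hB hAB)
  have hmem : ∀ y ∈ LinearMap.range γ ⊔ LinearMap.range ιM, πE y ∈ LinearMap.range f := by
    intro y hy
    obtain ⟨_, ⟨x, rfl⟩, _, ⟨z, rfl⟩, rfl⟩ := Submodule.mem_sup.1 hy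
    exact ⟨x, by rw [hγ, map_add, map_add, hEM, hEM, hEE, zero_add, add_zero]⟩
  let t : E →ₗ[S] LinearMap.range f :=
    (πE ∘ₗ Submodule.subtype _ ∘ₗ q ∘ₗ ιE).codRestrict _ fun y => hmem _ (q (ιE y)).2
  refine ⟨(LinearEquiv.ofInjective f hf).symm.toLinearMap ∘ₗ t, fun x => ?_⟩
  have hx : ιE (f x) ∈ LinearMap.range γ ⊔ LinearMap.range ιM := by
    have : ιE (f x) = γ x + ιM (-x) := by rw [hγ, map_neg]; abel
    rw [this]
    exact add_mem (Submodule.mem_sup_left ⟨x, rfl⟩) (Submodule.mem_sup_right ⟨-x, rfl⟩)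
  have ht : t (f x) = LinearEquiv.ofInjective f hf x := by
    refine Subtype.ext ?_
    change πE (q (ιE (f x))) = f x
    rw [hq ⟨_, hx⟩]
    exact hEE _
  change (LinearEquiv.ofInjective f hf).symm (t (f x)) = x
  rw [ht, LinearEquiv.symm_apply_apply]

theorem injective_of_classC_of_closedUnderFiniteDirectSums (h2 : 2 ≤ n) (h6 : n ≤ 6)
    (hC : (classC S n).ClosedUnderFiniteDirectSums) (h : classC S n M) :
    Module.Injective S M := by
  obtain ⟨Q, _, _, f, hQ, hf⟩ := exists_injective_embedding S M
  let X : Fin 2 → Type u := ![M, Q]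
  let _ : ∀ k, AddCommGroup (X k) := Fin.cases ‹_› (Fin.cases ‹_› finZeroElim)
  let _ : ∀ k, Module S (X k) := Fin.cases ‹_› (Fin.cases ‹_› finZeroElim)
  have hX : ∀ k, classC S n (X k) :=
    Fin.cases h (Fin.cases (classC_of_injective h2 h6 hQ) finZeroElim)
  have h3 : IsC3 S (⨁ k, X k) := isC3_of_classC h2 h6 (hC 2 X hX)
  obtain ⟨q, hq⟩ := h3.exists_leftInverse
    (ιM := DirectSum.lof S (Fin 2) X 0) (ιE := DirectSum.lof S (Fin 2) X 1)
    (πM := DirectSum.component S (Fin 2) X 0) (πE := DirectSum.component S (Fin 2) X 1)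
    (fun x => DirectSum.component.lof_self (M := X) S 0 x)
    (fun x => DirectSum.component.lof_self (M := X) S 1 x)
    (fun x => (DirectSum.component.of (M := X) S 0 1 x).trans (dif_neg (by decide)))
    (fun x => (DirectSum.component.of (M := X) S 1 0 x).trans (dif_neg (by decide))) hf
  exact injective_of_retract f q hq

/-- Each projection of the sum factors through the preenvelope `g`; together the factorizations form
a left inverse of `g`. The precover case is dual. -/
theorem closedUnderFiniteDirectSums_of_preenveloping (h2 : 2 ≤ n) (h6 : n ≤ 6)
    (hC : (classC S n).Preenveloping) : (classC S n).ClosedUnderFiniteDirectSums := by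
  intro m X _ _ hX
  obtain ⟨E, _, _, g, hE, hg⟩ := hC (⨁ k, X k)
  choose α hα using fun k => hg (X k) (hX k) (DirectSum.component S (Fin m) X k)
  refine classC_of_retract h2 h6 g (∑ k, DirectSum.lof S (Fin m) X k ∘ₗ α k) (fun x => ?_) hE
  have hx : ∀ k, α k (g x) = x k := fun k => LinearMap.congr_fun (hα k) x
  simp only [LinearMap.sum_apply, LinearMap.comp_apply, hx]
  exact DirectSum.sum_univ_of x

theorem closedUnderFiniteDirectSums_of_precovering (h2 : 2 ≤ n) (h6 : n ≤ 6)
    (hC : (classC S n).Precovering) : (classC S n).ClosedUnderFiniteDirectSums := by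
  intro m X _ _ hX
  obtain ⟨E, _, _, g, hE, hg⟩ := hC (⨁ k, X k)
  choose α hα using fun k => hg (X k) (hX k) (DirectSum.lof S (Fin m) X k)
  refine classC_of_retract h2 h6 (DirectSum.toModule S (Fin m) E α) g (fun x => ?_) hE
  refine LinearMap.congr_fun (f := g ∘ₗ DirectSum.toModule S (Fin m) E α) (g := LinearMap.id) ?_ x
  refine DirectSum.linearMap_ext S fun k => LinearMap.ext fun y => ?_
  simp only [LinearMap.comp_apply, DirectSum.toModule_lof, LinearMap.id_apply]
  exact LinearMap.congr_fun (hα k) y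

end Classes

/-! ### Injective semisimple modules and the noetherian condition -/

section Noetherian

variable {S : Type u} [Ring S] {M E : Type u} [AddCommGroup M] [Module S M]
  [AddCommGroup E] [Module S E]

/-- If simple modules are injective, they cogenerate all modules. -/
theorem exists_isSimpleModule_hom_ne_zero
    (hV : ∀ (T : Type u) [AddCommGroup T] [Module S T], IsSimpleModule S T → Module.Injective S T)
    {x : M} (hx : x ≠ 0) : ∃ (T : Type u) (_ : AddCommGroup T) (_ : Module S T)
      (φ : M →ₗ[S] T), IsSimpleModule S T ∧ φ x ≠ 0 := by
  let N := Submodule.span S {x}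
  let x' : N := ⟨x, Submodule.mem_span_singleton_self x⟩
  have hspan : ∀ K : Submodule S N, x' ∈ K → K = ⊤ := fun K hK => by
    rw [eq_top_iff]
    rintro ⟨y, hy⟩ -
    obtain ⟨r, rfl⟩ := Submodule.mem_span_singleton.1 hy
    exact K.smul_mem r hK
  have : Nontrivial N := ⟨x', 0, fun h => hx (congrArg Subtype.val h)⟩
  -- The cyclic module `N` has a maximal submodule `K`, which misses the generator `x'`; the simple
  -- quotient is injective, so the quotient map extends to `M`.
  obtain ⟨K, hK, -⟩ := (eq_top_or_exists_le_coatom (⊥ : Submodule S N)).resolve_left bot_ne_top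
  have hT : IsSimpleModule S (N ⧸ K) := isSimpleModule_iff_isCoatom.2 hK
  obtain ⟨φ, hφ⟩ := exists_extension (hV _ hT) K.mkQ
  refine ⟨N ⧸ K, inferInstance, inferInstance, φ, hT, fun h0 => hK.1 (hspan K ?_)⟩
  have : K.mkQ x' = 0 := (hφ x').symm.trans h0
  simpa using this

/-- Let a strictly growing chain `f n` have union `I`. Maps `φ n` to simple modules that kill `f n`
but not some `x n ∈ I` send `I` into `⨁ T n`, since each element of `I` lies in some `f m`. This sum
is semisimple, hence injective, so the map extends to `y ↦ y • h 1`; but `h 1` has finite support,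
contradicting `φ n (x n) ≠ 0` for all `n`. -/
theorem isNoetherianRing_of_isSemisimpleModule_injective
    (hS : ∀ (T : Type u) [AddCommGroup T] [Module S T],
      IsSemisimpleModule S T → Module.Injective S T) : IsNoetherianRing S := by
  classical
  refine monotone_stabilizes_iff_noetherian.1 fun f => ?_
  by_contra! hf
  let I : Submodule S S := ⨆ n, f n
  have hI : ∀ {x}, x ∈ I ↔ ∃ n, x ∈ f n := fun {x} =>
    Submodule.mem_iSup_of_directed _ f.monotone.directed_le
  have hex : ∀ n, ∃ x ∈ I, x ∉ f n := fun n => by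
    obtain ⟨m, hnm, hne⟩ := hf n
    obtain ⟨x, hx, hxn⟩ := SetLike.exists_of_lt (lt_of_le_of_ne (f.monotone hnm) hne)
    exact ⟨x, hI.2 ⟨m, hx⟩, hxn⟩
  choose x hxI hxn using hex
  have hφ : ∀ n, ∃ (T : Type u) (_ : AddCommGroup T) (_ : Module S T) (φ : S →ₗ[S] T),
      IsSimpleModule S T ∧ φ (x n) ≠ 0 ∧ ∀ y ∈ f n, φ y = 0 := fun n => by
    obtain ⟨T, _, _, φ, hT, hφ⟩ := exists_isSimpleModule_hom_ne_zero
      (fun T _ _ hT => hS T inferInstance) (x := (f n).mkQ (x n)) (by simpa using hxn n)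
    refine ⟨T, _, _, φ ∘ₗ (f n).mkQ, hT, hφ, fun y hy => ?_⟩
    have : (f n).mkQ y = 0 := by simpa using hy
    rw [LinearMap.comp_apply, this, map_zero]
  choose T _ _ φ hT hφx hφ0 using hφ
  let P := LinearMap.range (DirectSum.coeFnLinearMap S (M := T))
  have hsupp : ∀ y : I, (LinearMap.pi φ) y ∈ P := by
    rintro ⟨y, hy⟩
    obtain ⟨m, hm⟩ := hI.1 hy
    refine ⟨DFinsupp.mk (Finset.range m) fun k => φ k y, funext fun k => ?_⟩
    change (DFinsupp.mk (Finset.range m) fun k => φ k y) k = φ k y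
    rw [DFinsupp.mk_apply]
    split_ifs with hk
    · rfl
    · exact (hφ0 k y (f.monotone (not_lt.1 fun h => hk (Finset.mem_range.2 h)) hm)).symm
  have hss : IsSemisimpleModule S (⨁ n, T n) :=
    inferInstanceAs (IsSemisimpleModule S (Π₀ n, T n))
  have hP : IsSemisimpleModule S P := IsSemisimpleModule.range _
  obtain ⟨h, hh⟩ := exists_extension (hS P hP)
    ((LinearMap.pi φ ∘ₗ I.subtype).codRestrict P hsupp)
  obtain ⟨s, hs⟩ := (h 1).2
  obtain ⟨n, hn⟩ := Infinite.exists_notMem_finset (DFinsupp.support (ι := ℕ) (β := T) s)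
  have hsn : (h 1 : ∀ n, T n) n = 0 := by
    rw [← hs]
    exact DFinsupp.notMem_support_iff.1 hn
  refine hφx n ?_
  have h1 : (h (x n) : ∀ n, T n) n = φ n (x n) := by rw [hh ⟨x n, hxI n⟩]; rfl
  have h2 : h (x n) = x n • h 1 := by rw [← map_smul, smul_eq_mul, mul_one]
  rw [← h1, h2]
  change x n • (h 1 : ∀ n, T n) n = 0
  rw [hsn, smul_zero]

variable [IsNoetherianRing S]

/-- In Baer's criterion the image of a finitely generated ideal already lies in one member of `c`.
-/
theorem injective_sSup_of_directedOn {c : Set (Submodule S M)} (hc : c.Nonempty)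
    (hdir : DirectedOn (· ≤ ·) c) (h : ∀ D ∈ c, Module.Injective S D) :
    Module.Injective S ↥(sSup c) := by
  refine Module.Baer.injective fun I g => ?_
  have hfg : (LinearMap.range ((sSup c).subtype ∘ₗ g)).FG := Submodule.FG.of_finite
  obtain ⟨D, hD, hle⟩ := (Submodule.fg_iff_compact _).1 hfg c _ hc hdir (isLUB_sSup c)
    (by rintro _ ⟨y, rfl⟩; exact (g y).2)
  obtain ⟨k, hk⟩ := exists_extension (h D hD)
    (((sSup c).subtype ∘ₗ g).codRestrict D fun y => hle ⟨y, rfl⟩)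
  refine ⟨Submodule.inclusion (le_sSup hD) ∘ₗ k, fun y hy => Subtype.ext ?_⟩
  exact congrArg (fun z : D => (z : M)) (hk ⟨y, hy⟩)

theorem injective_directSum {ι : Type u} (X : ι → Type u) [∀ k, AddCommGroup (X k)]
    [∀ k, Module S (X k)] (hX : ∀ k, Module.Injective S (X k)) :
    Module.Injective S (⨁ k, X k) := by
  classical
  refine Module.Baer.injective fun I g => ?_
  choose h hh using fun k => exists_extension (hX k) (DirectSum.component S ι X k ∘ₗ g)
  obtain ⟨s, hs⟩ := (inferInstance : Module.Finite S I)
  let F : Finset ι := s.biUnion fun y => DFinsupp.support (β := X) (g y)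
  have hF : ∀ y : I, (∑ k ∈ F, DirectSum.lof S ι X k ∘ₗ h k) y = g y := by
    intro y
    have hy : y ∈ Submodule.span S (s : Set I) := hs ▸ Submodule.mem_top
    induction hy using Submodule.span_induction with
    | mem y hy =>
      have : ∀ k, h k y = g y k := fun k => hh k y
      simp only [LinearMap.sum_apply, LinearMap.comp_apply, this]
      refine (Finset.sum_subset (Finset.subset_biUnion_of_mem _ hy) fun k _ hk => ?_).symm.trans
        (DirectSum.sum_support_of (g y))
      rw [DFinsupp.notMem_support_iff.1 hk, map_zero]
    | zero => simp
    | add a b _ _ ha hb =>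
      rw [map_add g, ← ha, ← hb, ← map_add, Submodule.coe_add]
    | smul r a _ ha => rw [map_smul g, ← ha, ← map_smul, Submodule.coe_smul]
  exact ⟨_, fun y hy => hF ⟨y, hy⟩⟩

end Noetherian

/-! ### Injective envelopes and covers -/

section Approximations

variable {S : Type u} [Ring S] {M E : Type u} [AddCommGroup M] [Module S M]
  [AddCommGroup E] [Module S E]

/-- Since `α` is injective, its range is a summand; the range contains `N`, so a complement meets
`N` in zero and vanishes. -/
theorem bijective_of_eqOn_isEssentialIn (hE : Module.Injective S E) {N : Submodule S E}
    (hN : IsEssentialIn N ⊤) {α : E →ₗ[S] E} (hα : ∀ x ∈ N, α x = x) :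
    Function.Bijective α := by
  have hinj : Function.Injective α :=
    ker_eq_bot_of_isEssentialIn hN fun x hx h => (hα x hx).symm.trans h
  refine ⟨hinj, LinearMap.range_eq_top.1 ?_⟩
  obtain ⟨C, hC⟩ := isComplemented_range_of_injective hE hinj
  have hCbot : C = ⊥ := hN.2 C le_top (le_bot_iff.1 fun x hx =>
    hC.inf_eq_bot.le ⟨⟨x, hα x hx.2⟩, hx.1⟩)
  simpa [hCbot] using hC.sup_eq_top

/-- If the kernel of a map from an injective module contains no nonzero injective submodule,
then every endomorphism over that map is an automorphism. -/
theorem bijective_of_comp_eq (hE : Module.Injective S E) {f : E →ₗ[S] M}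
    (hf : ∀ K : Submodule S E, K ≤ LinearMap.ker f → Module.Injective S K → K = ⊥)
    {α : E →ₗ[S] E} (hα : f ∘ₗ α = f) : Function.Bijective α := by
  let β : E →ₗ[S] E := LinearMap.id - α
  have hβ : ∀ x, β x = x - α x := fun _ => rfl
  have hfβ : ∀ x, f (β x) = 0 := fun x => by
    rw [hβ, map_sub, sub_eq_zero]
    exact (LinearMap.congr_fun hα x).symm
  -- `ker β` is the set of fixed points of `α`. On the complement `B` of its hull `H`, `β` is
  -- injective, so `β(B)` is an injective submodule of `ker f`. Hence `B = ⊥` and the fixed points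
  -- are essential.
  obtain ⟨H, ⟨B, hHB⟩, hH⟩ := isC1_of_injective hE (LinearMap.ker β)
  have hinj : Function.Injective (β ∘ₗ B.subtype) := by
    rw [← LinearMap.ker_eq_bot, eq_bot_iff]
    intro b hb
    have : (b : E) ∈ H ⊓ B := ⟨hH.1 hb, b.2⟩
    rw [hHB.inf_eq_bot] at this
    simpa using this
  have hB : Module.Injective S B := injective_of_isComplemented ⟨H, hHB.symm⟩
  have h0 : LinearMap.range (β ∘ₗ B.subtype) = ⊥ := hf _
    (by rintro _ ⟨b, rfl⟩; exact hfβ b)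
    (injective_of_linearEquiv hB (LinearEquiv.ofInjective _ hinj).symm)
  have hBbot : B = ⊥ := by
    rw [eq_bot_iff]
    intro b hb
    have : β b = 0 := (Submodule.mem_bot S).1 (h0 ▸ ⟨⟨b, hb⟩, rfl⟩)
    exact hHB.inf_eq_bot.le ⟨hH.1 this, hb⟩
  have hHtop : H = ⊤ := by simpa [hBbot] using hHB.sup_eq_top
  exact bijective_of_eqOn_isEssentialIn hE (hHtop ▸ hH)
    fun x hx => (sub_eq_zero.1 (LinearMap.mem_ker.1 hx)).symm

theorem enveloping_of_forall_iff_injective {C : ModuleClass S}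
    (hC : ∀ (M : Type u) [AddCommGroup M] [Module S M], C M ↔ Module.Injective S M) :
    C.Enveloping := by
  intro M _ _
  obtain ⟨E, _, _, g, hE, hg, hess⟩ := exists_injective_hull S M
  refine ⟨E, _, _, g, ⟨(hC E).2 hE, fun E' _ _ hE' g' => ?_⟩, fun α hα => ?_⟩
  · have := (hC E').1 hE'
    exact Module.Injective.extension_property S E' M E g hg g'
  · refine bijective_of_eqOn_isEssentialIn hE hess ?_
    rintro _ ⟨x, rfl⟩
    exact LinearMap.congr_fun hα x

variable [IsNoetherianRing S]

/-- Let `π : P → M` be a map through which all maps to `M` from injective modules of a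
cogenerating family factor; here `Q J` is an injective module containing `S ⧸ J`. Then every map
from an injective module to `M` factors through `π`. -/
theorem exists_factorization_of_injective {P : Type u} [AddCommGroup P] [Module S P]
    {π : P →ₗ[S] M} {Q : Submodule S S → Type u} [∀ J, AddCommGroup (Q J)] [∀ J, Module S (Q J)]
    (hQ : ∀ J, Module.Injective S (Q J)) (u : ∀ J, (S ⧸ J) →ₗ[S] Q J)
    (hu : ∀ J, Function.Injective (u J))
    (hπ : ∀ (J) (h : Q J →ₗ[S] M), ∃ α : Q J →ₗ[S] P, π ∘ₗ α = h)
    (hE : Module.Injective S E) (f : E →ₗ[S] M) : ∃ α : E →ₗ[S] P, π ∘ₗ α = f := by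
  -- Zorn's lemma on partial factorizations with injective domain: such a domain splits off, leaving
  -- room to extend by the hull of a cyclic submodule of its complement.
  let A : Set (E →ₗ.[S] P) :=
    {α | Module.Injective S α.domain ∧ ∀ x : α.domain, π (α x) = f x}
  have hbot : (⊥ : E →ₗ.[S] P) ∈ A := by
    refine ⟨injective_of_isComplemented (A := (⊥ : Submodule S E)) isComplemented_bot, ?_⟩
    rintro ⟨x, hx⟩
    obtain rfl := (Submodule.mem_bot S).1 hx
    have : (⟨0, hx⟩ : (⊥ : E →ₗ.[S] P).domain) = 0 := rfl
    rw [this, LinearPMap.map_zero, map_zero]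
    exact (map_zero f).symm
  obtain ⟨α, -, hα⟩ := zorn_le_nonempty₀ A (fun c hc hchain y hy => by
    have hdir : DirectedOn (· ≤ ·) c := hchain.directedOn
    refine ⟨LinearPMap.sSup c hdir, ⟨?_, fun x => ?_⟩, fun z hz => LinearPMap.le_sSup hdir hz⟩
    · refine injective_sSup_of_directedOn (Set.Nonempty.image _ ⟨y, hy⟩) ?_ ?_
      · rintro _ ⟨a, ha, rfl⟩ _ ⟨b, hb, rfl⟩
        obtain ⟨z, hz, haz, hbz⟩ := hdir a ha b hb
        exact ⟨_, ⟨z, hz, rfl⟩, haz.1, hbz.1⟩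
      · rintro _ ⟨a, ha, rfl⟩
        exact (hc ha).1
    · obtain ⟨l, hl, hx⟩ := (LinearPMap.mem_domain_sSup_iff ⟨y, hy⟩ hdir).1 x.2
      have := LinearPMap.sSup_apply hdir hl ⟨x, hx⟩
      exact (congrArg π this).trans ((hc hl).2 ⟨x, hx⟩)) ⊥ hbot
  obtain ⟨⟨hαinj, hαf⟩, hmax⟩ := hα
  suffices htop : α.domain = ⊤ by
    refine ⟨α.toFun ∘ₗ (LinearMap.id.codRestrict α.domain fun x => htop ▸ Submodule.mem_top),
      LinearMap.ext fun x => hαf _⟩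
  obtain ⟨D, hD⟩ := isComplemented_of_injective hαinj
  by_contra hne
  have hDne : D ≠ ⊥ := fun h => hne (by simpa [h] using hD.sup_eq_top)
  obtain ⟨x, hxD, hx0⟩ := D.ne_bot_iff.1 hDne
  obtain ⟨H, hHc, hH⟩ := isC1_of_injective hE (Submodule.span S {x})
  have hdisj : α.domain ⊓ H = ⊥ := hH.2 _ inf_le_right (by
    rw [eq_bot_iff]
    rintro y ⟨⟨hy, -⟩, hyx⟩
    exact hD.inf_eq_bot.le ⟨hy, (Submodule.span_singleton_le_iff_mem x D).2 hxD hyx⟩)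
  have hxH : x ∈ H := hH.1 (Submodule.mem_span_singleton_self x)
  -- The span of `x` is isomorphic to `S ⧸ J`, so its hull `H` embeds in `Q J` and, being injective,
  -- is a retract of it. Thus `f` on `H` extends to `Q J` and factors through `π`.
  let J := LinearMap.ker (LinearMap.toSpanSingleton S E x)
  let e := (LinearMap.toSpanSingleton S E x).quotKerEquivRange
  obtain ⟨i, hi⟩ := exists_extension (hQ J) (u J ∘ₗ e.symm.toLinearMap)
  have hiH : Function.Injective (i ∘ₗ H.subtype) := by
    rw [← LinearMap.ker_eq_bot]
    refine Submodule.map_injective_of_injective H.subtype_injective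
      ((hH.2 _ (Submodule.map_subtype_le H _) ?_).trans (Submodule.map_bot _).symm)
    rw [eq_bot_iff]
    rintro _ ⟨⟨y, hy, rfl⟩, hyx⟩
    obtain ⟨r, hr⟩ := Submodule.mem_span_singleton.1 hyx
    have hy0 : u J (e.symm ⟨y, r, hr⟩) = 0 := (hi ⟨y, r, hr⟩).symm.trans hy
    have := (map_eq_zero_iff e.symm e.symm.injective).1
      ((map_eq_zero_iff (u J) (hu J)).1 hy0)
    exact congrArg Subtype.val this
  have hHinj : Module.Injective S H := injective_of_isComplemented hHc
  obtain ⟨p, hp⟩ := Module.Injective.extension_property S H H (Q J) _ hiH LinearMap.id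
  obtain ⟨γ, hγ⟩ := hπ J (f ∘ₗ H.subtype ∘ₗ p)
  let δ : E →ₗ.[S] P := ⟨H, γ ∘ₗ i ∘ₗ H.subtype⟩
  have hδ : ∀ y : H, π (δ y) = f y := fun y =>
    (LinearMap.congr_fun hγ (i y)).trans (congrArg (fun z : H => f z) (LinearMap.congr_fun hp y))
  have hcompat := LinearPMap.sup_h_of_disjoint α δ (disjoint_iff.2 hdisj)
  have hmem : α.sup δ hcompat ∈ A := by
    refine ⟨injective_of_isComplemented (A := α.domain ⊔ H)
      ((isQuasiInjective_of_injective hE).isC2.isC3 _ _ ⟨D, hD⟩ hHc hdisj), ?_⟩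
    rintro ⟨z, hz⟩
    obtain ⟨a, ha, b, hb, rfl⟩ := Submodule.mem_sup.1 hz
    refine (congrArg π
      (LinearPMap.sup_apply hcompat ⟨a, ha⟩ ⟨b, hb⟩ ⟨a + b, hz⟩ rfl)).trans ?_
    rw [map_add, hαf, map_add f]
    exact congrArg (f a + ·) (hδ ⟨b, hb⟩)
  have hle := hmax hmem (LinearPMap.left_le_sup α δ hcompat)
  have hxα : x ∈ α.domain := hle.1 (Submodule.mem_sup_right (S := α.domain) (T := H) hxH)
  exact hx0 ((Submodule.mem_bot S).1 (hdisj ▸ ⟨hxα, hxH⟩))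

/-- Injective modules over a noetherian ring form a precovering class. -/
theorem exists_injective_precover (S : Type u) [Ring S] [IsNoetherianRing S] (M : Type u)
    [AddCommGroup M] [Module S M] :
    ∃ (P : Type u) (_ : AddCommGroup P) (_ : Module S P) (π : P →ₗ[S] M),
      Module.Injective S P ∧ ∀ (E : Type u) [AddCommGroup E] [Module S E],
        Module.Injective S E → ∀ f : E →ₗ[S] M, ∃ α : E →ₗ[S] P, π ∘ₗ α = f := by
  classical
  choose Q _ _ u hQ hu using fun J : Submodule S S => exists_injective_embedding S (S ⧸ J)
  -- One summand for every map `Q J → M`; the left ideals `J` form a set, so the sum stays in the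
  -- universe.
  let ι := Σ J, Q J →ₗ[S] M
  let π : (⨁ k : ι, Q k.1) →ₗ[S] M := DirectSum.toModule S ι M fun k => k.2
  refine ⟨⨁ k : ι, Q k.1, inferInstance, inferInstance, π,
    injective_directSum _ fun k => hQ k.1, fun E _ _ hE f => ?_⟩
  refine exists_factorization_of_injective hQ u hu (fun J h => ?_) hE f
  exact ⟨DirectSum.lof S ι (fun k => Q k.1) ⟨J, h⟩, LinearMap.ext fun x =>
    DirectSum.toModule_lof (φ := fun k : ι => k.2) S ⟨J, h⟩ x⟩

theorem exists_maximal_injective_le (N : Submodule S M) :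
    ∃ K ≤ N, Module.Injective S K ∧
      ∀ K' ≤ N, Module.Injective S K' → K ≤ K' → K' = K := by
  obtain ⟨K, -, hK⟩ := zorn_le_nonempty₀ {K : Submodule S M | K ≤ N ∧ Module.Injective S K}
    (fun c hc hchain y hy => ⟨sSup c, ⟨sSup_le fun z hz => (hc hz).1,
      injective_sSup_of_directedOn ⟨y, hy⟩ hchain.directedOn fun z hz => (hc hz).2⟩,
      fun z hz => le_sSup hz⟩) ⊥
    ⟨bot_le, ⟨fun _ _ _ _ _ _ _ _ _ => ⟨0, fun _ => Subsingleton.elim _ _⟩⟩⟩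
  exact ⟨K, hK.prop.1, hK.prop.2, fun K' h h' hle => le_antisymm (hK.2 ⟨h, h'⟩ hle) hle⟩

theorem covering_of_forall_iff_injective {C : ModuleClass S}
    (hC : ∀ (M : Type u) [AddCommGroup M] [Module S M], C M ↔ Module.Injective S M) :
    C.Covering := by
  intro M _ _
  obtain ⟨P, _, _, π, hP, hπ⟩ := exists_injective_precover S M
  obtain ⟨K, hKπ, hK, hmax⟩ := exists_maximal_injective_le (LinearMap.ker π)
  obtain ⟨D, hKD⟩ := isComplemented_of_injective hK
  have hD : Module.Injective S D := injective_of_isComplemented ⟨K, hKD.symm⟩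
  refine ⟨D, inferInstance, inferInstance, π ∘ₗ D.subtype,
    ⟨(hC D).2 hD, fun E' _ _ hE' g' => ?_⟩, fun α hα => bijective_of_comp_eq hD ?_ hα⟩
  · obtain ⟨α, rfl⟩ := hπ E' ((hC E').1 hE') g'
    refine ⟨D.projectionOnto K hKD.symm ∘ₗ α, LinearMap.ext fun x => ?_⟩
    have hx : α x - D.projection K hKD.symm (α x) ∈ K := Submodule.sub_projection_mem hKD.symm _
    have := LinearMap.mem_ker.1 (hKπ hx)
    rw [map_sub, sub_eq_zero] at this
    exact this.symm
  · intro L hL hLinj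
    have hLP : Module.Injective S (L.map D.subtype) := injective_of_linearEquiv hLinj
      (Submodule.equivMapOfInjective D.subtype D.subtype_injective L).symm
    have hLD : L.map D.subtype ≤ D := Submodule.map_subtype_le D L
    have hdisj : K ⊓ L.map D.subtype = ⊥ :=
      le_bot_iff.1 ((inf_le_inf_left K hLD).trans hKD.inf_eq_bot.le)
    have hsup := hmax (K ⊔ L.map D.subtype)
      (sup_le hKπ (by rintro _ ⟨y, hy, rfl⟩; exact hL hy))
      (injective_of_isComplemented ((isQuasiInjective_of_injective hP).isC2.isC3 _ _
        ⟨D, hKD⟩ (isComplemented_of_injective hLP) hdisj)) le_sup_left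
    have hbot : L.map D.subtype = ⊥ := by
      rw [← hdisj, eq_comm, inf_eq_right]
      exact le_sup_right.trans hsup.le
    exact Submodule.map_injective_of_injective D.subtype_injective
      (hbot.trans (Submodule.map_bot _).symm)

end Approximations

/-! ### Uniform modules and semisimplicity of the ring -/

section Uniform

variable {S : Type u} [Ring S] {M E : Type u} [AddCommGroup M] [Module S M]
  [AddCommGroup E] [Module S E]

/-- A module is uniform if the intersection of two nonzero submodules is nonzero
(the zero module is allowed). -/
def IsUniform (S : Type u) [Ring S] (M : Type u) [AddCommGroup M] [Module S M] : Prop :=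
  ∀ A B : Submodule S M, A ⊓ B = ⊥ → A = ⊥ ∨ B = ⊥

theorem IsUniform.submodule (h : IsUniform S M) (U : Submodule S M) : IsUniform S U := by
  intro A B hAB
  have hinj := Submodule.map_injective_of_injective U.subtype_injective
  have := h (A.map U.subtype) (B.map U.subtype) (by
    rw [← Submodule.map_inf _ U.subtype_injective, hAB, Submodule.map_bot])
  rw [← Submodule.map_bot U.subtype] at this
  exact this.imp (fun h => hinj h) fun h => hinj h

theorem IsUniform.eq_bot_or_eq_top (h : IsUniform S M) {A : Submodule S M}
    (hA : IsComplemented A) : A = ⊥ ∨ A = ⊤ := by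
  obtain ⟨B, hB⟩ := hA
  exact (h A B hB.inf_eq_bot).imp_right fun h0 => by simpa [h0] using hB.sup_eq_top

theorem IsUniform.of_isEssentialIn_range (h : IsUniform S M) {g : M →ₗ[S] E}
    (hg : Function.Injective g) (hess : IsEssentialIn (LinearMap.range g) ⊤) :
    IsUniform S E := by
  have key : ∀ A : Submodule S E, A.comap g = ⊥ → A = ⊥ := fun A hA => by
    refine hess.2 A le_top ?_
    rw [eq_bot_iff]
    rintro _ ⟨hx, x, rfl⟩
    have : x ∈ A.comap g := hx
    rw [hA, Submodule.mem_bot] at this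
    simp [this]
  intro A B hAB
  have := h (A.comap g) (B.comap g) (by
    rw [← Submodule.comap_inf, hAB, eq_bot_iff]
    intro x hx
    exact (Submodule.mem_bot S).2 (hg (((Submodule.mem_bot S).1 hx).trans (map_zero g).symm)))
  exact this.imp (key A) (key B)

theorem IsUniform.isC1 (h : IsUniform S M) : IsC1 S M := by
  intro N
  by_cases hN : N = ⊥
  · exact ⟨⊥, isComplemented_bot, hN ▸ isEssentialIn_refl _⟩
  · exact ⟨⊤, isComplemented_top, le_top, fun K _ hK => (h K N hK).resolve_right hN⟩

/-- Maximal submodules of uniform injective modules are continuous. -/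
theorem IsUniform.isContinuous_of_isCoatom (h : IsUniform S E) (hE : Module.Injective S E)
    {U : Submodule S E} (hU : IsCoatom U) : IsContinuous S U := by
  refine ⟨(h.submodule U).isC1, ?_⟩
  rintro A D hD ⟨e⟩
  obtain rfl | rfl := (h.submodule U).eq_bot_or_eq_top hD
  · have : Subsingleton A := e.toEquiv.subsingleton
    rw [(Submodule.subsingleton_iff_eq_bot).1 this]
    exact isComplemented_bot
  by_cases hU0 : U = ⊥
  · subst hU0
    rw [Subsingleton.elim A ⊥]
    exact isComplemented_bot
  -- In the remaining case `A ≅ U`, so `m` is an injective endomorphism of `U` with image `A`. Its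
  -- extension `k` to `E` is an automorphism, and maximality of `U` gives `k⁻¹(U) = U`; hence `A =
  -- U`.
  let m : U →ₗ[S] U := A.subtype ∘ₗ (Submodule.topEquiv.symm ≪≫ₗ e.symm).toLinearMap
  have hm : Function.Injective m :=
    A.subtype_injective.comp (Submodule.topEquiv.symm ≪≫ₗ e.symm).injective
  obtain ⟨k, hk⟩ := exists_extension hE (U.subtype ∘ₗ m)
  have hkU : ∀ y ∈ U, k y ∈ U := fun y hy => by
    rw [hk ⟨y, hy⟩]
    exact (m ⟨y, hy⟩).2
  have hkinj : Function.Injective k := by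
    rw [← LinearMap.ker_eq_bot]
    refine (h _ U ?_).resolve_right hU0
    rw [eq_bot_iff]
    rintro y ⟨hy, hyU⟩
    have : m ⟨y, hyU⟩ = 0 := Subtype.ext ((hk ⟨y, hyU⟩).symm.trans hy)
    exact congrArg Subtype.val ((map_eq_zero_iff m hm).1 this)
  have hksurj : LinearMap.range k = ⊤ := by
    refine (h.eq_bot_or_eq_top (isComplemented_range_of_injective hE hkinj)).resolve_left
      fun h0 => hU0 ?_
    rw [eq_bot_iff]
    intro y hy
    rw [LinearMap.range_eq_bot] at h0
    exact hkinj (by rw [h0]; rfl)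
  have hcomap : U.comap k = U := by
    refine (hU.le_iff.1 (show U ≤ U.comap k from hkU)).resolve_left fun htop => hU.1 ?_
    rw [eq_top_iff, ← hksurj]
    rintro _ ⟨y, rfl⟩
    exact (htop ▸ Submodule.mem_top : y ∈ U.comap k)
  have hA : A = ⊤ := by
    rw [eq_top_iff]
    rintro ⟨y, hy⟩ -
    obtain ⟨z, rfl⟩ := LinearMap.range_eq_top.1 hksurj y
    have hz : z ∈ U := hcomap ▸ (show z ∈ U.comap k from hy)
    have hmz : m ⟨z, hz⟩ = ⟨k z, hy⟩ := Subtype.ext (hk ⟨z, hz⟩).symm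
    rw [← hmz]
    exact (e.symm _).2
  exact hA ▸ isComplemented_top

/-- A noetherian ring which is not semisimple has a uniform module which is not semisimple. -/
theorem exists_isUniform_not_isSemisimpleModule [IsNoetherianRing S] (hS : ¬ IsSemisimpleRing S) :
    ∃ (M : Type u) (_ : AddCommGroup M) (_ : Module S M),
      IsUniform S M ∧ ¬ IsSemisimpleModule S M := by
  -- By maximality of `I`, every proper quotient of `S ⧸ I` is semisimple. Two nonzero submodules
  -- with zero intersection would embed `S ⧸ I` in a product of two such quotients.
  obtain ⟨I, hI, hmax⟩ := set_has_maximal_iff_noetherian.2 ‹IsNoetherianRing S›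
    {I : Submodule S S | ¬ IsSemisimpleModule S (S ⧸ I)} ⟨⊥, fun h =>
      hS (.congr (Submodule.quotEquivOfEqBot (⊥ : Submodule S S) rfl).symm)⟩
  refine ⟨S ⧸ I, inferInstance, inferInstance, ?_, hI⟩
  have hquot : ∀ A : Submodule S (S ⧸ I), A ≠ ⊥ → IsSemisimpleModule S ((S ⧸ I) ⧸ A) := by
    intro A hA
    have hlt : I < A.comap I.mkQ := by
      refine lt_of_le_of_ne (Submodule.le_comap_mkQ I A) fun h => hA ?_
      rw [← Submodule.map_comap_eq_of_surjective I.mkQ_surjective A, ← h, Submodule.mkQ_map_self]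
    have hss : IsSemisimpleModule S (S ⧸ A.comap I.mkQ) := by
      by_contra h
      exact hmax _ h hlt
    refine .congr ((Submodule.quotEquivOfEq _ _ ?_).trans
      (Submodule.quotientQuotientEquivQuotient I (A.comap I.mkQ) hlt.le))
    exact (Submodule.map_comap_eq_of_surjective I.mkQ_surjective A).symm
  intro A B hAB
  by_contra! hne
  have : ∀ b : Bool, IsSemisimpleModule S ((S ⧸ I) ⧸ cond b A B) :=
    Bool.rec (hquot B hne.2) (hquot A hne.1)
  refine hI (.of_injective (LinearMap.pi fun b : Bool => (cond b A B).mkQ) ?_)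
  rw [← LinearMap.ker_eq_bot, LinearMap.ker_pi]
  simp only [Submodule.ker_mkQ]
  rw [iInf_bool_eq]
  exact hAB

theorem isSemisimpleRing_of_isContinuous_injective
    (hS : ∀ (T : Type u) [AddCommGroup T] [Module S T],
      IsSemisimpleModule S T → Module.Injective S T)
    (hC : ∀ (T : Type u) [AddCommGroup T] [Module S T],
      IsContinuous S T → Module.Injective S T) : IsSemisimpleRing S := by
  have := isNoetherianRing_of_isSemisimpleModule_injective hS
  by_contra hne
  obtain ⟨M, _, _, hM, hMss⟩ := exists_isUniform_not_isSemisimpleModule hne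
  obtain ⟨E, _, _, g, hE, hg, hess⟩ := exists_injective_hull S M
  have hEu : IsUniform S E := hM.of_isEssentialIn_range hg hess
  have hEss : ¬ IsSemisimpleModule S E := fun h => hMss (.of_injective g hg)
  obtain ⟨x, hx⟩ : ∃ x : E, x ≠ 0 := by
    by_contra! h0
    have : Subsingleton E := ⟨fun a b => (h0 a).trans (h0 b).symm⟩
    exact hEss { exists_isCompl := fun A =>
      ⟨⊤, by rw [Subsingleton.elim A ⊥]; exact isCompl_bot_top⟩ }
  obtain ⟨T, _, _, φ, hT, hφ⟩ := exists_isSimpleModule_hom_ne_zero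
    (fun T _ _ hT => hS T inferInstance) hx
  have hφ0 : φ ≠ 0 := fun h => hφ (by rw [h]; rfl)
  have hU : IsCoatom (LinearMap.ker φ) := by
    rw [← isSimpleModule_iff_isCoatom]
    exact .congr (φ.quotKerEquivOfSurjective (LinearMap.surjective_of_ne_zero hφ0))
  have hUinj := hC _ (hEu.isContinuous_of_isCoatom hE hU)
  obtain h0 | h1 := hEu.eq_bot_or_eq_top (isComplemented_of_injective hUinj)
  · exact hEss (.of_injective φ (LinearMap.ker_eq_bot.1 h0))
  · exact hU.1 h1

end Uniform

/-! ### Assembling the equivalences -/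

section Main

variable {S : Type u} [Ring S] {n : ℕ}

theorem injective_of_isSemisimpleModule (h2 : 2 ≤ n) (h6 : n ≤ 6)
    (hC : ∀ (M : Type u) [AddCommGroup M] [Module S M], classC S n M → Module.Injective S M)
    (M : Type u) [AddCommGroup M] [Module S M] (hM : IsSemisimpleModule S M) :
    Module.Injective S M :=
  hC M (classC_of_isSemisimpleModule h2 h6)

theorem ModuleClass.Enveloping.preenveloping {C : ModuleClass S} (h : C.Enveloping) :
    C.Preenveloping := fun M _ _ =>
  let ⟨E, i₁, i₂, g, hg⟩ := h M
  ⟨E, i₁, i₂, g, hg.1⟩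

theorem ModuleClass.Covering.precovering {C : ModuleClass S} (h : C.Covering) :
    C.Precovering := fun M _ _ =>
  let ⟨E, i₁, i₂, g, hg⟩ := h M
  ⟨E, i₁, i₂, g, hg.1⟩

theorem classC_tfae (h2 : 2 ≤ n) (h6 : n ≤ 6) :
    List.TFAE [
      (classC S n).ClosedUnderFiniteDirectSums,
      ∀ (M : Type u) [AddCommGroup M] [Module S M], classC S n M ↔ Module.Injective S M,
      (classC S n).Preenveloping,
      (classC S n).Enveloping,
      (classC S n).Precovering,
      (classC S n).Covering] := by
  tfae_have 1 → 2 := fun h M _ _ =>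
    ⟨injective_of_classC_of_closedUnderFiniteDirectSums h2 h6 h, classC_of_injective h2 h6⟩
  tfae_have 2 → 4 := enveloping_of_forall_iff_injective
  tfae_have 4 → 3 := ModuleClass.Enveloping.preenveloping
  tfae_have 3 → 1 := closedUnderFiniteDirectSums_of_preenveloping h2 h6
  tfae_have 2 → 6 := fun h => by
    have := isNoetherianRing_of_isSemisimpleModule_injective
      (injective_of_isSemisimpleModule h2 h6 fun M _ _ => (h M).1)
    exact covering_of_forall_iff_injective h
  tfae_have 6 → 5 := ModuleClass.Covering.precovering
  tfae_have 5 → 1 := closedUnderFiniteDirectSums_of_precovering h2 h6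
  tfae_finish

theorem closedUnderFiniteDirectSums_iff_isSemisimpleRing (h2 : 2 ≤ n) (h5 : n ≤ 5) :
    (classC S n).ClosedUnderFiniteDirectSums ↔ IsSemisimpleRing S := by
  have h6 : n ≤ 6 := h5.trans (by norm_num)
  refine ⟨fun h => ?_, fun h m X _ _ _ =>
    classC_of_injective h2 h6 (Module.injective_of_isSemisimpleRing S _)⟩
  have hC : ∀ (M : Type u) [AddCommGroup M] [Module S M], classC S n M → Module.Injective S M :=
    fun M _ _ => injective_of_classC_of_closedUnderFiniteDirectSums h2 h6 h
  exact isSemisimpleRing_of_isContinuous_injective (injective_of_isSemisimpleModule h2 h6 hC)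
    fun T _ _ hT => hC T (classC_of_isContinuous h2 h5 hT)

theorem isRightNoetherian_of_isNoetherianRing_mulOpposite (R : Type u) [Ring R]
    [IsNoetherianRing Rᵐᵒᵖ] : IsRightNoetherian R :=
  isNoetherian_of_surjective (M := Rᵐᵒᵖ) (LinearMap.toSpanSingleton Rᵐᵒᵖ R 1) <|
    LinearMap.range_eq_top.2 fun x => ⟨MulOpposite.op x, by simp⟩

end Main

end GenInj

theorem theorem3p2 (R : Type u) [Ring R] (i : ℕ) (hi₂ : 2 ≤ i) (hi₆ : i ≤ 6) :
    List.TFAE [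
      (GenInj.classC Rᵐᵒᵖ i).ClosedUnderFiniteDirectSums,
      ∀ (M : Type u) [AddCommGroup M] [Module Rᵐᵒᵖ M],
        GenInj.classC Rᵐᵒᵖ i M ↔ Module.Injective Rᵐᵒᵖ M,
      (GenInj.classC Rᵐᵒᵖ i).Preenveloping,
      (GenInj.classC Rᵐᵒᵖ i).Enveloping,
      (GenInj.classC Rᵐᵒᵖ i).Precovering,
      (GenInj.classC Rᵐᵒᵖ i).Covering] ∧
    ((GenInj.classC Rᵐᵒᵖ i).ClosedUnderFiniteDirectSums →
      GenInj.IsRightNoetherian R ∧ GenInj.IsRightVRing R ∧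
      ∀ (M : Type u) [AddCommGroup M] [Module Rᵐᵒᵖ M],
        IsSemisimpleModule Rᵐᵒᵖ M → Module.Injective Rᵐᵒᵖ M) ∧
    (i ≠ 6 → ((GenInj.classC Rᵐᵒᵖ i).ClosedUnderFiniteDirectSums ↔ IsSemisimpleRing R)) := by
  refine ⟨GenInj.classC_tfae hi₂ hi₆, fun h => ?_, fun hi => ?_⟩
  · have hss := GenInj.injective_of_isSemisimpleModule hi₂ hi₆ fun M _ _ =>
      GenInj.injective_of_classC_of_closedUnderFiniteDirectSums (M := M) hi₂ hi₆ h
    have := GenInj.isNoetherianRing_of_isSemisimpleModule_injective hss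
    exact ⟨GenInj.isRightNoetherian_of_isNoetherianRing_mulOpposite R,
      fun M _ _ hM => hss M inferInstance, hss⟩
  · rw [GenInj.closedUnderFiniteDirectSums_iff_isSemisimpleRing hi₂ (by omega),
      isSemisimpleRing_mulOpposite_iff]
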